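/- Let $W$ be one of the finite irreducible Coxeter groups $\alpha_n$, $\beta_n$ ($n\ge 2$), $\mathrm{Dih}_d$ ($d\ge 3$, $n=2$) or $H_3$ ($n=3$), acting on Euclidean space $\mathbb R^n$ as the group generated by the simple reflections $S=\{s_1,\dots,s_n\}$ (numbered along the Coxeter graph), where the mirrors $H_i$ of the $s_i$ are linearly independent and $W$ acts as in its standard geometric representation. Let $W^*$ be its subgroup of rotations and $Z(W)$ its centre. For $I\subset S$ let $C_I=\bigcap_{s_i\in I}H_i\cap\bigcap_{s_i\notin I}H_i^+$, where $H_i^+$ is the open positive half-space of $s_i$, and let $\overline J$ be the image of $J\subset S$ under $s_i\mapsto s_{n-i+1}$. Let $I,J\subset S$ be non-empty with $|I|=|J|=n-1$, and fix points $p\in C_I$ and $q\in C_J$, with $p=q$ if $I=J$. A seed strut of type $(W,I,J)$ is an unordered pair $\{a,b\}$ of distinct points with $a\in Wp$ and $b\in Wq$; seed struts are counted up to the action of $W$. For a subgroup $G\le W$, a seed strut $x$ generates the set of struts $Gx=\{\{r(a),r(b)\} : r\in G\}$, and an endpoint of $x$ is univalent (with respect to $G$) if it belongs to exactly one strut of $Gx$.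 **Theorem.** Let $G=W$; or let $G=W^*$ and assume that $n\ge 3$ or $I=J$. If either $Z(W)$ is non-trivial and $I=J$, or $Z(W)$ is trivial and $I=\overline J$, then there is, up to the action of $W$, exactly one seed strut of type $(W,I,J)$ with a univalent endpoint. In all other cases there is none. -/

import Mathlib

/-- The irreducible Coxeter groups under consideration, given by their Coxeter matrices:
`α_n` (linear graph without labels), `β_n` (linear graph with one extreme edge labelled `4`),
the dihedral groups `dih_d` with `d ≥ 3` (`CoxeterMatrix.I m` has label `m + 2`), and `H_3`. -/
inductive IsConsidered : {n : ℕ} → CoxeterMatrix (Fin n) → Prop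
  | alpha (n : ℕ) (hn : 1 ≤ n) : IsConsidered (CoxeterMatrix.A n)
  | beta (n : ℕ) (hn : 2 ≤ n) : IsConsidered (CoxeterMatrix.B n)
  | dih (d : ℕ) (hd : 3 ≤ d) : IsConsidered (CoxeterMatrix.I (d - 2))
  | icosahedral : IsConsidered CoxeterMatrix.H₃

/-- The symmetric bilinear form on `ℝ^n` with `B(α_i, α_j) = -cos (π / m(i, j))` for the standard
basis `α_1, …, α_n` (the simple roots). For a finite Coxeter group it is positive definite, i.e.
`(ℝ^n, B)` is a Euclidean space, written in the basis of unit simple roots. -/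
noncomputable def coxForm {n : ℕ} (M : CoxeterMatrix (Fin n)) :
    LinearMap.BilinForm ℝ (Fin n → ℝ) :=
  Matrix.toBilin' (Matrix.of fun i j => -Real.cos (Real.pi / (M i j : ℝ)))

/-- The simple root `α_i`. -/
def simpleRoot {n : ℕ} (i : Fin n) : Fin n → ℝ := Pi.single i 1

theorem coxForm_simpleRoot_self {n : ℕ} (M : CoxeterMatrix (Fin n)) (i : Fin n) :
    ((2 : ℝ) • coxForm M (simpleRoot i)) (simpleRoot i) = 2 := by
  simp [coxForm, simpleRoot]

/-- The simple reflection `s_i : v ↦ v - 2 B(α_i, v) α_i`. -/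
noncomputable def simpleRefl {n : ℕ} (M : CoxeterMatrix (Fin n)) (i : Fin n) :
    (Fin n → ℝ) ≃ₗ[ℝ] (Fin n → ℝ) :=
  Module.reflection (coxForm_simpleRoot_self M i)

/-- The Coxeter group `W`, as the group of isometries generated by the simple reflections. -/
noncomputable def reflGroup {n : ℕ} (M : CoxeterMatrix (Fin n)) :
    Subgroup ((Fin n → ℝ) ≃ₗ[ℝ] (Fin n → ℝ)) :=
  Subgroup.closure (Set.range (simpleRefl M))

/-- The rotation subgroup `W^*`: the elements of `W` of determinant `1`. -/
noncomputable def rotGroup {n : ℕ} (M : CoxeterMatrix (Fin n)) :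
    Subgroup ((Fin n → ℝ) ≃ₗ[ℝ] (Fin n → ℝ)) :=
  reflGroup M ⊓ (LinearEquiv.det : ((Fin n → ℝ) ≃ₗ[ℝ] (Fin n → ℝ)) →* ℝˣ).ker

/-- The facet `C_I`: the intersection of the mirrors `H_i`, `i ∈ I`, and of the open positive
half-spaces `H_i^+`, `i ∉ I`. A set `I` of simple reflections is given by their indices. -/
def facet {n : ℕ} (M : CoxeterMatrix (Fin n)) (I : Finset (Fin n)) : Set (Fin n → ℝ) :=
  {v | (∀ i ∈ I, coxForm M (simpleRoot i) v = 0) ∧ ∀ i ∉ I, 0 < coxForm M (simpleRoot i) v}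

/-- `x` is a strut: an unordered pair of distinct endpoints, one in the `W`-orbit of `p` and one
in the `W`-orbit of `q`. -/
def IsStrut {n : ℕ} (M : CoxeterMatrix (Fin n)) (p q : Fin n → ℝ) (x : Sym2 (Fin n → ℝ)) : Prop :=
  ∃ u ∈ reflGroup M, ∃ w ∈ reflGroup M, u p ≠ w q ∧ x = s(u p, w q)

/-- The set of images of the strut `x` under the group `G`. For `G = W^*` this is the
polypolyhedron generated by the seed strut `x`; for `G = W` it is the orbit of `x`, i.e. the
class of all seed struts equivalent to `x`. -/
def generated {V : Type*} [AddCommGroup V] [Module ℝ V] (G : Subgroup (V ≃ₗ[ℝ] V)) (x : Sym2 V) :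
    Set (Sym2 V) :=
  {y | ∃ r ∈ G, y = x.map r}

/-- Some endpoint of `x` is incident to exactly one strut of the set `generated G x`. -/
def HasUnivalentEndpoint {V : Type*} [AddCommGroup V] [Module ℝ V] (G : Subgroup (V ≃ₗ[ℝ] V))
    (x : Sym2 V) : Prop :=
  ∃ a ∈ x, {y ∈ generated G x | a ∈ y}.encard = 1

/-- The number of seed struts with endpoints in the orbits of `p` and `q`, counted up to
equivalence under `W`, that have a univalent endpoint in the set of struts generated by `G`. -/
noncomputable def numUnivalent {n : ℕ} (M : CoxeterMatrix (Fin n))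
    (G : Subgroup ((Fin n → ℝ) ≃ₗ[ℝ] (Fin n → ℝ))) (p q : Fin n → ℝ) : ℕ∞ :=
  {O : Set (Sym2 (Fin n → ℝ)) | ∃ x, IsStrut M p q x ∧ HasUnivalentEndpoint G x ∧
    O = generated (reflGroup M) x}.encard

/-- The dual `J̄` of a set of simple reflections: its image under `s_i ↦ s_{n-i+1}`. -/
def dualSet {n : ℕ} (J : Finset (Fin n)) : Finset (Fin n) := J.image Fin.rev

/-!
Let `W` be finite and let `p` be a point on an extreme ray of the closed fundamental chamber. If the
endpoint `p` of a strut `{p, g q}` is univalent, every element of `G` that fixes `p` fixes `g q`.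
Since the mirrors through `p` meet in the line `ℝ p`, this puts `g q` on that line, and `g q` must
be a negative multiple of `p`, because every orbit meets the chamber in exactly one point.
Conversely, the endpoints of a strut `{p, t p}` with `t < 0` are univalent. (For rotations one
multiplies reflections in pairs; in the plane, where this is impossible, Cayley-Hamilton does the
job.)

So the question is whether the opposite of the ray of `p` lies in the orbit of the ray of `q`. Since
`W` is simply transitive on its chambers, this is decided by the longest element `w₀`: the map
`-w₀` permutes the simple roots by an automorphism `σ` of the Coxeter graph, and the condition is
that `σ` maps `J` to `I`. For a path, `σ` is the identity or the flip, and it is the identity if and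
only if `-1` lies in `W`, that is, if and only if the centre of `W` is non-trivial.

Finiteness of the groups considered is seen from a finite set of linear forms that separates points
and that the simple reflections permute up to sign.
-/

section SimpleReflections

variable {n : ℕ} (M : CoxeterMatrix (Fin n))

theorem coxForm_apply (v w : Fin n → ℝ) :
    coxForm M v w = ∑ i, ∑ j, v i * (-Real.cos (Real.pi / (M i j : ℝ))) * w j := by
  simp [coxForm, Matrix.toBilin'_apply]

theorem coxForm_simpleRoot_left (i : Fin n) (v : Fin n → ℝ) :
    coxForm M (simpleRoot i) v = ∑ j, -Real.cos (Real.pi / (M i j : ℝ)) * v j := by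
  simp [coxForm_apply, simpleRoot, Pi.single_apply]

theorem coxForm_simpleRoot_simpleRoot (i j : Fin n) :
    coxForm M (simpleRoot i) (simpleRoot j) = -Real.cos (Real.pi / (M i j : ℝ)) := by
  simp [coxForm, simpleRoot]

theorem coxForm_simpleRoot_same (i : Fin n) :
    coxForm M (simpleRoot i) (simpleRoot i) = 1 := by
  simp [coxForm_simpleRoot_simpleRoot]

theorem coxForm_comm (v w : Fin n → ℝ) : coxForm M v w = coxForm M w v := by
  rw [coxForm_apply, coxForm_apply, Finset.sum_comm]
  refine Finset.sum_congr rfl fun i _ => Finset.sum_congr rfl fun j _ => ?_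
  rw [M.symmetric j i]
  ring

theorem eq_sum_smul_simpleRoot (v : Fin n → ℝ) : v = ∑ i, v i • simpleRoot i := by
  simpa [simpleRoot] using pi_eq_sum_univ' v

theorem simpleRefl_apply (i : Fin n) (v : Fin n → ℝ) :
    simpleRefl M i v = v - (2 * coxForm M (simpleRoot i) v) • simpleRoot i := by
  simp [simpleRefl, Module.reflection_apply]

theorem simpleRefl_simpleRoot_self (i : Fin n) :
    simpleRefl M i (simpleRoot i) = -simpleRoot i :=
  Module.reflection_apply_self _

theorem simpleRefl_simpleRoot (i j : Fin n) :
    simpleRefl M i (simpleRoot j) =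
      simpleRoot j + (2 * Real.cos (Real.pi / (M i j : ℝ))) • simpleRoot i := by
  rw [simpleRefl_apply, coxForm_simpleRoot_simpleRoot]
  module

theorem simpleRefl_mul_self (i : Fin n) : simpleRefl M i * simpleRefl M i = 1 := by
  rw [mul_eq_one_iff_eq_inv]
  exact (Module.reflection_inv _).symm

theorem coxForm_simpleRefl (i : Fin n) (v w : Fin n → ℝ) :
    coxForm M (simpleRefl M i v) (simpleRefl M i w) = coxForm M v w := by
  simp only [simpleRefl_apply, map_sub, map_smul, LinearMap.sub_apply, LinearMap.smul_apply,
    smul_eq_mul, coxForm_simpleRoot_same, coxForm_comm M v (simpleRoot i)]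
  ring

theorem det_simpleRefl (i : Fin n) : LinearEquiv.det (simpleRefl M i) = -1 := by
  have h : (simpleRefl M i : (Fin n → ℝ) →ₗ[ℝ] (Fin n → ℝ)) =
      LinearMap.transvection ((-2 : ℝ) • coxForm M (simpleRoot i)) (simpleRoot i) := by
    ext1 v
    ext1
    simp [simpleRefl_apply, LinearMap.transvection.apply]
    ring
  ext
  rw [LinearEquiv.coe_det, h, LinearMap.transvection.det, LinearMap.smul_apply,
    coxForm_simpleRoot_same]
  norm_num

theorem simpleRefl_mem (i : Fin n) : simpleRefl M i ∈ reflGroup M :=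
  Subgroup.subset_closure ⟨i, rfl⟩

variable {M}

theorem coxForm_map {g : (Fin n → ℝ) ≃ₗ[ℝ] (Fin n → ℝ)} (hg : g ∈ reflGroup M)
    (v w : Fin n → ℝ) : coxForm M (g v) (g w) = coxForm M v w := by
  induction hg using Subgroup.closure_induction generalizing v w with
  | mem x hx =>
    obtain ⟨i, rfl⟩ := hx
    exact coxForm_simpleRefl M i v w
  | one => rfl
  | mul x y _ _ hx hy => rw [LinearEquiv.mul_apply, LinearEquiv.mul_apply, hx, hy]
  | inv x _ hx =>
    rw [← hx, ← LinearEquiv.mul_apply, ← LinearEquiv.mul_apply, mul_inv_cancel]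
    rfl

theorem det_of_mem {g : (Fin n → ℝ) ≃ₗ[ℝ] (Fin n → ℝ)} (hg : g ∈ reflGroup M) :
    LinearEquiv.det g = 1 ∨ LinearEquiv.det g = -1 := by
  induction hg using Subgroup.closure_induction with
  | mem x hx =>
    obtain ⟨i, rfl⟩ := hx
    exact Or.inr (det_simpleRefl M i)
  | one => exact Or.inl (map_one _)
  | mul x y _ _ hx hy => rcases hx with h | h <;> rcases hy with h' | h' <;> simp [h, h']
  | inv x _ hx => rcases hx with h | h <;> simp [h]

end SimpleReflections

section GeometricRepresentation

open Polynomial.Chebyshev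

theorem sin_two_mul_pi_div_pos {m : ℕ} (hm : 3 ≤ m) : 0 < Real.sin (2 * (Real.pi / m)) := by
  have hm' : (3 : ℝ) ≤ m := by exact_mod_cast hm
  apply Real.sin_pos_of_pos_of_lt_pi
  · positivity
  · rw [mul_div, div_lt_iff₀ (by positivity)]
    nlinarith [Real.pi_pos]

theorem eval_S_two_mul_cos_eq_zero {m : ℕ} (hm : 3 ≤ m) {k : ℕ} (hk : m = 2 * k) :
    (S ℝ (k - 1)).eval (2 * Real.cos (2 * (Real.pi / m))) = 0 := by
  have hsin := sin_two_mul_pi_div_pos hm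
  have h := S_two_mul_real_cos (2 * (Real.pi / m)) (k - 1)
  have hπ : ((k - 1 : ℤ) + 1 : ℝ) * (2 * (Real.pi / m)) = Real.pi := by
    subst hk
    have : (k : ℝ) ≠ 0 := by norm_cast; omega
    push_cast
    field_simp
    ring
  rw [hπ, Real.sin_pi] at h
  exact (mul_eq_zero.1 h).resolve_right hsin.ne'

theorem eval_S_add_eval_S_two_mul_cos_eq_zero {m : ℕ} (hm : 3 ≤ m) {k : ℕ} (hk : m = 2 * k + 1) :
    (S ℝ k).eval (2 * Real.cos (2 * (Real.pi / m))) +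
      (S ℝ (k - 1)).eval (2 * Real.cos (2 * (Real.pi / m))) = 0 := by
  have hsin := sin_two_mul_pi_div_pos hm
  have h := S_two_mul_real_cos (2 * (Real.pi / m)) k
  have h' := S_two_mul_real_cos (2 * (Real.pi / m)) (k - 1)
  have hπ : ((k : ℤ) + 1 : ℝ) * (2 * (Real.pi / m)) =
      2 * Real.pi - ((k - 1 : ℤ) + 1 : ℝ) * (2 * (Real.pi / m)) := by
    subst hk
    push_cast
    field_simp
    ring
  rw [hπ, Real.sin_two_pi_sub] at h
  refine (mul_eq_zero.1 (?_ : _ * Real.sin (2 * (Real.pi / m)) = 0)).resolve_right hsin.ne'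
  rw [add_mul, h, h', neg_add_cancel]

theorem reflection_mul_reflection_pow_eq_one {V : Type*} [AddCommGroup V] [Module ℝ V] {x y : V}
    {f g : Module.Dual ℝ V} (hf : f x = 2) (hg : g y = 2) {m : ℕ} (hm : 2 ≤ m)
    (hfy : f y = -(2 * Real.cos (Real.pi / m))) (hgx : g x = -(2 * Real.cos (Real.pi / m))) :
    (Module.reflection hf * Module.reflection hg) ^ m = 1 := by
  ext z
  rw [Module.reflection_mul_reflection_pow_apply hf hg m z (2 * Real.cos (2 * (Real.pi / m)))
    (by rw [hfy, hgx, Real.cos_two_mul]; ring), LinearEquiv.coe_one, id]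
  obtain rfl | hm := hm.eq_or_lt
  · norm_num [hfy, hgx, mul_div_cancel₀]
    abel
  obtain ⟨k, hk | hk⟩ := m.even_or_odd'
  · have h₁ : ((m : ℤ) - 2) / 2 = k - 1 := by omega
    have h₂ : ((m : ℤ) - 1) / 2 = k - 1 := by omega
    simp [h₁, h₂, eval_S_two_mul_cos_eq_zero hm hk]
  · have h₁ : ((m : ℤ) - 2) / 2 = k - 1 := by omega
    have h₂ : ((m : ℤ) - 1) / 2 = k := by omega
    have h₃ : ((m : ℤ) - 3) / 2 = k - 1 := by omega
    have h₄ : (m : ℤ) / 2 = k := by omega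
    simp [h₁, h₂, h₃, h₄, eval_S_add_eval_S_two_mul_cos_eq_zero hm hk]

variable {n : ℕ} (M : CoxeterMatrix (Fin n))

theorem isLiftable_simpleRefl : M.IsLiftable (simpleRefl M) := by
  intro i j
  obtain rfl | hij := eq_or_ne i j
  · rw [M.diagonal, pow_one, simpleRefl_mul_self]
  obtain hm | hm := eq_or_ne (M i j) 0
  · rw [hm, pow_zero]
  have hm' : 2 ≤ M i j := by have := M.off_diagonal i j hij; omega
  refine reflection_mul_reflection_pow_eq_one _ _ hm' ?_ ?_
  · simp [coxForm_simpleRoot_simpleRoot]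
  · simp [coxForm_simpleRoot_simpleRoot, M.symmetric j i]

/-- The geometric representation of the abstract Coxeter group of `M`, which sends its simple
generators to the simple reflections. -/
noncomputable def geomRep : M.Group →* ((Fin n → ℝ) ≃ₗ[ℝ] (Fin n → ℝ)) :=
  M.toCoxeterSystem.lift ⟨simpleRefl M, isLiftable_simpleRefl M⟩

theorem geomRep_simple (i : Fin n) : geomRep M (M.toCoxeterSystem.simple i) = simpleRefl M i :=
  M.toCoxeterSystem.lift_apply_simple _ i

theorem range_geomRep : (geomRep M).range = reflGroup M := by
  rw [MonoidHom.range_eq_map, ← M.toCoxeterSystem.subgroup_closure_range_simple,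
    MonoidHom.map_closure, ← Set.range_comp, reflGroup]
  exact congrArg _ (congrArg _ (funext (geomRep_simple M)))

theorem geomRep_mem (w : M.Group) : geomRep M w ∈ reflGroup M :=
  range_geomRep M ▸ ⟨w, rfl⟩

theorem geomRep_wordProd_alternatingWord (i j : Fin n) (k : ℕ) :
    geomRep M (M.toCoxeterSystem.wordProd (CoxeterSystem.alternatingWord i j k)) (simpleRoot i) =
      (U ℝ k).eval (Real.cos (Real.pi / M i j)) • simpleRoot (if Even k then i else j) +
      (U ℝ (k - 1)).eval (Real.cos (Real.pi / M i j)) • simpleRoot (if Even k then j else i) := by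
  induction k with
  | zero => simp [CoxeterSystem.alternatingWord]
  | succ k ih =>
    have hU : U ℝ ((k + 1 : ℕ) : ℤ) = 2 * Polynomial.X * U ℝ k - U ℝ (k - 1) := by
      rw [← U_add_one, Nat.cast_succ]
    rw [CoxeterSystem.alternatingWord_succ', CoxeterSystem.wordProd_cons, map_mul,
      LinearEquiv.mul_apply, ih, geomRep_simple, hU]
    by_cases hk : Even k <;>
      simp [hk, Nat.even_add_one, simpleRefl_simpleRoot, M.symmetric j i] <;>
      module

end GeometricRepresentation

section Positivity

open CoxeterSystem Polynomial.Chebyshev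

theorem exists_mul_alternatingWord_of_not_isRightDescent {B W : Type*} [Group W]
    {M : CoxeterMatrix B} (cs : CoxeterSystem M W) (w : W) (i j : B)
    (hw : ¬cs.IsRightDescent w i) :
    ∃ (v : W) (k : ℕ), w = v * cs.wordProd (alternatingWord i j k) ∧
      cs.length w = cs.length v + k ∧ ¬cs.IsRightDescent v i ∧ ¬cs.IsRightDescent v j := by
  induction hl : cs.length w generalizing w i j with
  | zero =>
    obtain rfl := cs.length_eq_zero_iff.1 hl
    exact ⟨1, 0, by simp [alternatingWord], by simp, hw, cs.not_isRightDescent_one j⟩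
  | succ l ih =>
    by_cases hj : cs.IsRightDescent w j
    · have hlen := cs.isRightDescent_iff.1 hj
      obtain ⟨v, k, hv, hk, hvj, hvi⟩ := ih (w * cs.simple j) j i
        (cs.isRightDescent_iff_not_isRightDescent_mul.1 hj) (by omega)
      refine ⟨v, k + 1, ?_, by omega, hvi, hvj⟩
      rw [alternatingWord_succ, wordProd_concat, ← mul_assoc, ← hv,
        cs.simple_mul_simple_cancel_right]
    · exact ⟨w, 0, by simp [alternatingWord], by omega, hw, hj⟩

theorem lt_of_not_isRightDescent_mul_alternatingWord {B W : Type*} [Group W]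
    {M : CoxeterMatrix B} {cs : CoxeterSystem M W} {v : W} {i j : B} {k : ℕ}
    (hlen : cs.length (v * cs.wordProd (alternatingWord i j k)) = cs.length v + k)
    (hi : ¬cs.IsRightDescent (v * cs.wordProd (alternatingWord i j k)) i) (hM : M i j ≠ 0) :
    k < M i j := by
  by_contra! hk
  apply cs.not_isReduced_alternatingWord j i (m := k + 1) (M.symmetric i j ▸ hM)
    (by rw [M.symmetric j i]; omega)
  have h₁ := cs.not_isRightDescent_iff.1 hi
  rw [mul_assoc, ← wordProd_concat, ← alternatingWord_succ] at h₁
  have h₂ := cs.length_mul_le v (cs.wordProd (alternatingWord j i (k + 1)))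
  have h₃ := cs.length_wordProd_le (alternatingWord j i (k + 1))
  rw [CoxeterSystem.IsReduced]
  rw [length_alternatingWord] at h₃ ⊢
  omega

theorem eval_U_cos_pi_div_nonneg {m k : ℕ} (hk : m ≠ 0 → k ≤ m) :
    0 ≤ (U ℝ (k - 1)).eval (Real.cos (Real.pi / m)) := by
  obtain rfl | hm := eq_or_ne m 0
  · simp
  specialize hk hm
  obtain rfl | hm₁ := eq_or_ne m 1
  · interval_cases k <;> simp
  have hm₂ : (1 : ℝ) < m := by exact_mod_cast (by omega : 1 < m)
  have hsin : 0 < Real.sin (Real.pi / m) :=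
    Real.sin_pos_of_pos_of_lt_pi (by positivity) (div_lt_self Real.pi_pos hm₂)
  refine nonneg_of_mul_nonneg_left ?_ hsin
  rw [U_real_cos]
  push_cast
  rw [sub_add_cancel]
  apply Real.sin_nonneg_of_nonneg_of_le_pi (by positivity)
  calc (k : ℝ) * (Real.pi / m) ≤ m * (Real.pi / m) := by gcongr
    _ = Real.pi := by field_simp

variable {n : ℕ} {M : CoxeterMatrix (Fin n)}

theorem simpleRoot_nonneg (i : Fin n) : 0 ≤ (simpleRoot i : Fin n → ℝ) :=
  Pi.single_nonneg.2 zero_le_one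

theorem simpleRoot_injective : Function.Injective (simpleRoot : Fin n → Fin n → ℝ) :=
  fun i j h => by simpa [simpleRoot, Pi.single_apply] using congrFun h i

theorem simpleRoot_ne_zero (i : Fin n) : (simpleRoot i : Fin n → ℝ) ≠ 0 :=
  Pi.single_ne_zero_iff.2 one_ne_zero

theorem geomRep_simpleRoot_nonneg {w : M.Group} {i : Fin n}
    (hw : ¬M.toCoxeterSystem.IsRightDescent w i) : 0 ≤ geomRep M w (simpleRoot i) := by
  induction hl : M.toCoxeterSystem.length w using Nat.strong_induction_on generalizing w i with
  | h l ih =>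
    obtain rfl | hw₁ := eq_or_ne w 1
    · simpa using simpleRoot_nonneg i
    obtain ⟨j, hj⟩ := M.toCoxeterSystem.exists_rightDescent_of_ne_one hw₁
    obtain ⟨v, k, rfl, hlen, hvi, hvj⟩ :=
      exists_mul_alternatingWord_of_not_isRightDescent M.toCoxeterSystem w i j hw
    have hk₀ : k ≠ 0 := by
      rintro rfl
      simp only [alternatingWord, wordProd_nil, mul_one] at hj
      exact hvj hj
    have hk : M i j ≠ 0 → k < M i j := lt_of_not_isRightDescent_mul_alternatingWord hlen hw
    have hi := ih _ (by omega) hvi rfl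
    have hj := ih _ (by omega) hvj rfl
    have h₁ := eval_U_cos_pi_div_nonneg (m := M i j) (k := k + 1) (by omega)
    have h₀ := eval_U_cos_pi_div_nonneg (m := M i j) (k := k) (by omega)
    rw [map_mul, LinearEquiv.mul_apply, geomRep_wordProd_alternatingWord, map_add, map_smul,
      map_smul]
    push_cast at h₁
    rw [add_sub_cancel_right] at h₁
    split_ifs
    · exact add_nonneg (smul_nonneg h₁ hi) (smul_nonneg h₀ hj)
    · exact add_nonneg (smul_nonneg h₁ hj) (smul_nonneg h₀ hi)

theorem geomRep_simpleRoot_nonpos {w : M.Group} {i : Fin n}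
    (hw : M.toCoxeterSystem.IsRightDescent w i) : geomRep M w (simpleRoot i) ≤ 0 := by
  have h := geomRep_simpleRoot_nonneg
    (M.toCoxeterSystem.isRightDescent_iff_not_isRightDescent_mul.1 hw)
  rwa [map_mul, LinearEquiv.mul_apply, geomRep_simple, simpleRefl_simpleRoot_self, map_neg,
    Left.nonneg_neg_iff] at h

theorem eq_one_of_geomRep_simpleRoot_nonneg {w : M.Group}
    (h : ∀ i, 0 ≤ geomRep M w (simpleRoot i)) : w = 1 := by
  by_contra hw
  obtain ⟨i, hi⟩ := M.toCoxeterSystem.exists_rightDescent_of_ne_one hw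
  have h₀ := (geomRep_simpleRoot_nonpos hi).antisymm (h i)
  exact simpleRoot_ne_zero i ((LinearEquiv.map_eq_zero_iff _).1 h₀)

theorem geomRep_injective : Function.Injective (geomRep M) := by
  refine (injective_iff_map_eq_one _).2 fun w hw => eq_one_of_geomRep_simpleRoot_nonneg fun i => ?_
  rw [hw]
  exact simpleRoot_nonneg i

theorem eq_one_of_simpleRoot_nonneg {g : (Fin n → ℝ) ≃ₗ[ℝ] (Fin n → ℝ)} (hg : g ∈ reflGroup M)
    (h : ∀ i, 0 ≤ g (simpleRoot i)) : g = 1 := by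
  rw [← range_geomRep] at hg
  obtain ⟨w, rfl⟩ := hg
  rw [eq_one_of_geomRep_simpleRoot_nonneg h, map_one]

end Positivity

section Facets

variable {n : ℕ} {M : CoxeterMatrix (Fin n)} {I J : Finset (Fin n)} {p q v : Fin n → ℝ}

/-- A vector is dominant if it lies in the closed fundamental chamber, the intersection of the
closed positive half-spaces of the simple reflections. -/
def Dominant (M : CoxeterMatrix (Fin n)) (v : Fin n → ℝ) : Prop :=
  ∀ i, 0 ≤ coxForm M (simpleRoot i) v

theorem Dominant.geomRep_le (hv : Dominant M v) (w : M.Group) : geomRep M w v ≤ v := by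
  induction hl : M.toCoxeterSystem.length w using Nat.strong_induction_on generalizing w with
  | h l ih =>
    obtain rfl | hw := eq_or_ne w 1
    · rw [map_one, LinearEquiv.coe_one, id]
    obtain ⟨i, hi⟩ := M.toCoxeterSystem.exists_rightDescent_of_ne_one hw
    obtain ⟨u, rfl⟩ : ∃ u, w = u * M.toCoxeterSystem.simple i :=
      ⟨_, (M.toCoxeterSystem.simple_mul_simple_cancel_right i).symm⟩
    have hu := geomRep_simpleRoot_nonpos hi
    rw [map_mul, LinearEquiv.mul_apply, geomRep_simple, simpleRefl_simpleRoot_self, map_neg,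
      Left.neg_nonpos_iff] at hu
    have hlt := M.toCoxeterSystem.isRightDescent_iff.1 hi
    rw [M.toCoxeterSystem.simple_mul_simple_cancel_right] at hlt
    calc geomRep M (u * M.toCoxeterSystem.simple i) v
        = geomRep M u v - (2 * coxForm M (simpleRoot i) v) • geomRep M u (simpleRoot i) := by
          rw [map_mul, LinearEquiv.mul_apply, geomRep_simple, simpleRefl_apply, map_sub, map_smul]
      _ ≤ geomRep M u v := sub_le_self _ (smul_nonneg (mul_nonneg zero_le_two (hv i)) hu)
      _ ≤ v := ih _ (by omega) u rfl

theorem Dominant.map_le (hv : Dominant M v) {g : (Fin n → ℝ) ≃ₗ[ℝ] (Fin n → ℝ)}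
    (hg : g ∈ reflGroup M) : g v ≤ v := by
  rw [← range_geomRep] at hg
  obtain ⟨w, rfl⟩ := hg
  exact hv.geomRep_le w

theorem Dominant.map_eq_self {g : (Fin n → ℝ) ≃ₗ[ℝ] (Fin n → ℝ)} (hv : Dominant M v)
    (hg : g ∈ reflGroup M) (hgv : Dominant M (g v)) : g v = v := by
  refine (hv.map_le hg).antisymm ?_
  simpa [← LinearEquiv.mul_apply] using hgv.map_le (inv_mem hg)

theorem dominant_of_mem_facet (hp : p ∈ facet M I) : Dominant M p := by
  intro i
  by_cases hi : i ∈ I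
  · exact (hp.1 i hi).ge
  · exact (hp.2 i hi).le

theorem smul_mem_facet (hp : p ∈ facet M I) {t : ℝ} (ht : 0 < t) : t • p ∈ facet M I := by
  refine ⟨fun i hi => ?_, fun i hi => ?_⟩
  · rw [map_smul, hp.1 i hi, smul_zero]
  · rw [map_smul]
    exact mul_pos ht (hp.2 i hi)

theorem mem_iff_of_mem_facet (hp : p ∈ facet M I) {i : Fin n} :
    i ∈ I ↔ coxForm M (simpleRoot i) p = 0 :=
  ⟨hp.1 i, fun h => by_contra fun hi => (hp.2 i hi).ne' h⟩

theorem eq_of_mem_facet (hp : p ∈ facet M I) (hp' : p ∈ facet M J) : I = J := by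
  ext i
  rw [mem_iff_of_mem_facet hp, mem_iff_of_mem_facet hp']

theorem eq_smul_of_map_eq_smul {g : (Fin n → ℝ) ≃ₗ[ℝ] (Fin n → ℝ)} (hg : g ∈ reflGroup M)
    (hp : p ∈ facet M I) (hq : q ∈ facet M J) {t : ℝ} (ht : 0 < t) (h : g q = t • p) :
    q = t • p := by
  rw [← h]
  refine ((dominant_of_mem_facet hq).map_eq_self hg ?_).symm
  rw [h]
  exact dominant_of_mem_facet (smul_mem_facet hp ht)

theorem simpleRefl_apply_of_mem_facet (hp : p ∈ facet M I) {i : Fin n} (hi : i ∈ I) :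
    simpleRefl M i p = p := by
  rw [simpleRefl_apply, hp.1 i hi, mul_zero, zero_smul, sub_zero]

theorem eq_zero_of_forall_coxForm_eq_zero [Finite (reflGroup M)]
    (hv : ∀ i, coxForm M (simpleRoot i) v = 0) : v = 0 := by
  have := Fintype.ofFinite (reflGroup M)
  have hfix : reflGroup M ≤ MulAction.stabilizer _ v := by
    rw [reflGroup, Subgroup.closure_le]
    rintro _ ⟨i, rfl⟩
    change simpleRefl M i v = v
    rw [simpleRefl_apply, hv, mul_zero, zero_smul, sub_zero]
  ext k
  -- The coordinate functional at `k` averaged over the group is invariant, so kills every root.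
  let F : Module.Dual ℝ (Fin n → ℝ) :=
    ∑ g : reflGroup M, LinearMap.proj k ∘ₗ (g : (Fin n → ℝ) ≃ₗ[ℝ] (Fin n → ℝ)).toLinearMap
  have hinv (i : Fin n) (x : Fin n → ℝ) : F (simpleRefl M i x) = F x := by
    simp only [F, LinearMap.sum_apply]
    exact Fintype.sum_equiv (Equiv.mulRight ⟨simpleRefl M i, simpleRefl_mem M i⟩) _ _ fun g => rfl
  have hF (i : Fin n) : F (simpleRoot i) = 0 := by
    have h := hinv i (simpleRoot i)
    rw [simpleRefl_simpleRoot_self, map_neg] at h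
    linarith
  have hFv : F v = 0 := by
    rw [eq_sum_smul_simpleRoot v, map_sum]
    exact Finset.sum_eq_zero fun i _ => by rw [map_smul, hF, smul_zero]
  have hcard : F v = Nat.card (reflGroup M) * v k := by
    have h (g : reflGroup M) : (g : (Fin n → ℝ) ≃ₗ[ℝ] (Fin n → ℝ)) v = v := hfix g.2
    simp [F, LinearMap.sum_apply, h]
  rw [hcard, mul_eq_zero] at hFv
  exact hFv.resolve_left (Nat.cast_ne_zero.2 Nat.card_pos.ne')

theorem exists_forall_notMem_iff (hI : I.card + 1 = n) : ∃ k, ∀ i, i ∉ I ↔ i = k := by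
  have : Iᶜ.card = 1 := by rw [Finset.card_compl, Fintype.card_fin]; omega
  obtain ⟨k, hk⟩ := Finset.card_eq_one.1 this
  exact ⟨k, fun i => by rw [← Finset.mem_compl, hk, Finset.mem_singleton]⟩

theorem ne_zero_of_mem_facet (hI : I.card + 1 = n) (hp : p ∈ facet M I) : p ≠ 0 := by
  obtain ⟨k, hk⟩ := exists_forall_notMem_iff hI
  rintro rfl
  simpa using hp.2 k ((hk k).2 rfl)

theorem exists_eq_smul_of_mem_facet [Finite (reflGroup M)] (hI : I.card + 1 = n)
    (hp : p ∈ facet M I) (hv : ∀ i ∈ I, coxForm M (simpleRoot i) v = 0) :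
    ∃ t : ℝ, v = t • p := by
  obtain ⟨k, hk⟩ := exists_forall_notMem_iff hI
  have hpk := hp.2 k ((hk k).2 rfl)
  refine ⟨coxForm M (simpleRoot k) v / coxForm M (simpleRoot k) p, sub_eq_zero.1 ?_⟩
  refine eq_zero_of_forall_coxForm_eq_zero (M := M) fun i => ?_
  by_cases hi : i ∈ I
  · simp [hv i hi, hp.1 i hi]
  · obtain rfl := (hk i).1 hi
    rw [map_sub, map_smul, smul_eq_mul, div_mul_cancel₀ _ hpk.ne', sub_self]

end Facets

section Opposition

variable {n : ℕ} {M : CoxeterMatrix (Fin n)} {I J : Finset (Fin n)} {p q : Fin n → ℝ}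

theorem exists_symm_simpleRoot_eq_smul {g : (Fin n → ℝ) ≃ₗ[ℝ] (Fin n → ℝ)}
    (h : ∀ i, g (simpleRoot i) ≤ 0) (h' : ∀ i, g.symm (simpleRoot i) ≤ 0) (i : Fin n) :
    ∃ j, ∃ c ≤ (0 : ℝ), g.symm (simpleRoot j) = c • simpleRoot i := by
  obtain ⟨j, hj⟩ := Function.ne_iff.1 ((LinearEquiv.map_ne_zero_iff g).2 (simpleRoot_ne_zero i))
  refine ⟨j, g.symm (simpleRoot j) i, h' j i, ?_⟩
  ext k
  obtain rfl | hk := eq_or_ne k i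
  · simp [simpleRoot]
  have hsum : ∑ l, g (simpleRoot i) l * g.symm (simpleRoot l) k = 0 := by
    calc _ = g.symm (∑ l, g (simpleRoot i) l • simpleRoot l) k := by simp
      _ = simpleRoot i k := by rw [← eq_sum_smul_simpleRoot, g.symm_apply_apply]
      _ = 0 := by simp [simpleRoot, hk]
  have hterm := (Finset.sum_eq_zero_iff_of_nonneg fun l _ =>
    mul_nonneg_of_nonpos_of_nonpos (h i l) (h' l k)).1 hsum j (Finset.mem_univ j)
  rw [(mul_eq_zero.1 hterm).resolve_left hj]
  simp [simpleRoot, hk]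

theorem exists_map_simpleRoot_eq_neg {g : (Fin n → ℝ) ≃ₗ[ℝ] (Fin n → ℝ)} (hg : g ∈ reflGroup M)
    (h : ∀ i, g (simpleRoot i) ≤ 0) (h' : ∀ i, g.symm (simpleRoot i) ≤ 0) (i : Fin n) :
    ∃ j, g (simpleRoot i) = -simpleRoot j := by
  obtain ⟨j, c, hc, hj⟩ := exists_symm_simpleRoot_eq_smul h h' i
  have hroot : simpleRoot j = c • g (simpleRoot i) := by
    rw [← map_smul, ← hj, g.apply_symm_apply]
  have hcc : c * c = 1 := by
    have := coxForm_simpleRoot_same M j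
    rwa [hroot, map_smul, map_smul, LinearMap.smul_apply, coxForm_map hg,
      coxForm_simpleRoot_same, smul_eq_mul, smul_eq_mul, mul_one] at this
  obtain rfl : c = -1 := (mul_self_eq_one_iff.1 hcc).resolve_left (by linarith)
  exact ⟨j, by rw [hroot, neg_one_smul, neg_neg]⟩

/-- `w₀` is the longest element of the Coxeter group, which maps the fundamental chamber to its
opposite, and `σ` is the permutation of the simple roots induced by `-w₀`. -/
structure IsOpposition (M : CoxeterMatrix (Fin n)) (w₀ : (Fin n → ℝ) ≃ₗ[ℝ] (Fin n → ℝ))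
    (σ : Equiv.Perm (Fin n)) : Prop where
  mem : w₀ ∈ reflGroup M
  map_simpleRoot : ∀ i, w₀ (simpleRoot i) = -simpleRoot (σ i)

theorem exists_isOpposition [Finite (reflGroup M)] : ∃ w₀ σ, IsOpposition M w₀ σ := by
  have : Finite M.Group := Finite.of_injective
    (fun w => (⟨geomRep M w, geomRep_mem M w⟩ : reflGroup M))
    fun _ _ h => geomRep_injective (congrArg Subtype.val h)
  obtain ⟨w, hw⟩ := Finite.exists_max M.toCoxeterSystem.length
  have hdesc (u : M.Group) (hu : M.toCoxeterSystem.length u = M.toCoxeterSystem.length w)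
      (i : Fin n) : geomRep M u (simpleRoot i) ≤ 0 := by
    have hne := M.toCoxeterSystem.length_mul_simple_ne u i
    exact geomRep_simpleRoot_nonpos (lt_of_le_of_ne (hu ▸ hw _) hne)
  have hinv (i : Fin n) : (geomRep M w).symm (simpleRoot i) ≤ 0 := by
    have := hdesc w⁻¹ (M.toCoxeterSystem.length_inv w) i
    rwa [map_inv] at this
  choose σ hσ using exists_map_simpleRoot_eq_neg (geomRep_mem M w) (hdesc w rfl) hinv
  have hσinj : Function.Injective σ := by
    intro i j hij
    have := (geomRep M w).injective ((hσ i).trans (hij ▸ (hσ j).symm))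
    exact simpleRoot_injective this
  exact ⟨_, Equiv.ofBijective σ (Finite.injective_iff_bijective.1 hσinj), geomRep_mem M w, hσ⟩

variable {w₀ : (Fin n → ℝ) ≃ₗ[ℝ] (Fin n → ℝ)} {σ : Equiv.Perm (Fin n)}

theorem IsOpposition.coxeterMatrix_apply (h : IsOpposition M w₀ σ) (i j : Fin n) :
    M (σ i) (σ j) = M i j := by
  have hB := coxForm_map h.mem (simpleRoot i) (simpleRoot j)
  rw [h.map_simpleRoot, h.map_simpleRoot, map_neg, map_neg, LinearMap.neg_apply, neg_neg,
    coxForm_simpleRoot_simpleRoot, coxForm_simpleRoot_simpleRoot, neg_inj] at hB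
  have hmem (m : ℕ) : Real.pi / m ∈ Set.Icc 0 Real.pi :=
    ⟨by positivity, div_nat_le_self_of_nonnneg Real.pi_pos.le m⟩
  have hdiv := Real.injOn_cos (hmem _) (hmem _) hB
  rw [div_eq_mul_inv, div_eq_mul_inv, mul_right_inj' Real.pi_ne_zero, inv_inj] at hdiv
  exact_mod_cast hdiv

theorem IsOpposition.neg_map_mem_facet (h : IsOpposition M w₀ σ) (hq : q ∈ facet M J) :
    -w₀ q ∈ facet M (J.image σ) := by
  have hB (i : Fin n) : coxForm M (simpleRoot (σ i)) (-w₀ q) = coxForm M (simpleRoot i) q := by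
    rw [← coxForm_map h.mem (simpleRoot i), h.map_simpleRoot, map_neg, map_neg,
      LinearMap.neg_apply]
  constructor
  · intro k hk
    obtain ⟨i, hi, rfl⟩ := Finset.mem_image.1 hk
    rw [hB, hq.1 i hi]
  · intro k hk
    obtain ⟨i, rfl⟩ := σ.surjective k
    rw [hB]
    exact hq.2 i fun hi => hk (Finset.mem_image_of_mem σ hi)

theorem IsOpposition.exists_map_eq_neg_smul_iff [Finite (reflGroup M)] (h : IsOpposition M w₀ σ)
    (hI : I.card + 1 = n) (hp : p ∈ facet M I) (hq : q ∈ facet M J) :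
    (∃ g ∈ reflGroup M, ∃ t < (0 : ℝ), g q = t • p) ↔ I = J.image σ := by
  have hq' := h.neg_map_mem_facet hq
  constructor
  · rintro ⟨g, hg, t, ht, hgq⟩
    have hqp := eq_smul_of_map_eq_smul (mul_mem hg (inv_mem h.mem)) hp hq' (neg_pos.2 ht)
      (by simp [hgq])
    exact eq_of_mem_facet (hqp ▸ smul_mem_facet hp (neg_pos.2 ht)) hq'
  · rintro rfl
    obtain ⟨t, ht⟩ := exists_eq_smul_of_mem_facet hI hp hq'.1
    obtain ⟨k, hk⟩ := exists_forall_notMem_iff hI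
    have hpk := hp.2 k ((hk k).2 rfl)
    have hqk := hq'.2 k ((hk k).2 rfl)
    rw [ht, map_smul, smul_eq_mul] at hqk
    refine ⟨w₀, h.mem, -t, neg_neg_of_pos (pos_of_mul_pos_left hqk hpk.le), ?_⟩
    rw [neg_smul, ← ht, neg_neg]

end Opposition

section Centre

variable {n : ℕ} {M : CoxeterMatrix (Fin n)}

/-- The Coxeter graph without its labels, in which two distinct simple reflections are adjacent if
they do not commute. -/
def coxeterGraph (M : CoxeterMatrix (Fin n)) : SimpleGraph (Fin n) where
  Adj i j := i ≠ j ∧ M i j ≠ 2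
  symm := ⟨fun i j h => ⟨h.1.symm, M.symmetric i j ▸ h.2⟩⟩
  loopless := ⟨fun _ h => h.1 rfl⟩

theorem coxForm_simpleRoot_ne_zero_of_adj {i j : Fin n} (h : (coxeterGraph M).Adj i j) :
    coxForm M (simpleRoot i) (simpleRoot j) ≠ 0 := by
  rw [coxForm_simpleRoot_simpleRoot, neg_ne_zero]
  have h₁ := M.off_diagonal i j h.1
  have h₂ := h.2
  obtain h₀ | h₃ : M i j = 0 ∨ 2 < M i j := by omega
  · simp [h₀]
  · have h₃' : (2 : ℝ) < M i j := by exact_mod_cast h₃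
    have hlt : Real.pi / M i j < Real.pi / 2 := by gcongr
    have hpos : 0 ≤ Real.pi / M i j := by positivity
    exact (Real.cos_pos_of_mem_Ioo ⟨by linarith [Real.pi_pos], hlt⟩).ne'

theorem map_simpleRoot_of_mem_center {g : reflGroup M} (hg : g ∈ Subgroup.center (reflGroup M))
    (i : Fin n) : ∃ c : ℝ, g.1 (simpleRoot i) = c • simpleRoot i := by
  have hcomm : simpleRefl M i (g.1 (simpleRoot i)) = -g.1 (simpleRoot i) := by
    have h := congrArg Subtype.val (Subgroup.mem_center_iff.1 hg ⟨_, simpleRefl_mem M i⟩)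
    have := congrArg (fun f => f (simpleRoot i)) h
    simpa [simpleRefl_simpleRoot_self] using this
  refine ⟨coxForm M (simpleRoot i) (g.1 (simpleRoot i)), ?_⟩
  rw [simpleRefl_apply] at hcomm
  linear_combination (norm := module) (1 / 2 : ℝ) • hcomm

theorem eq_one_or_eq_neg_one_of_mem_center (hM : (coxeterGraph M).Preconnected)
    {g : reflGroup M} (hg : g ∈ Subgroup.center (reflGroup M)) :
    g = 1 ∨ ∀ i, g.1 (simpleRoot i) = -simpleRoot i := by
  choose c hc using map_simpleRoot_of_mem_center hg
  have hmul (i j : Fin n) (hij : coxForm M (simpleRoot i) (simpleRoot j) ≠ 0) : c i * c j = 1 := by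
    have h := coxForm_map g.2 (simpleRoot i) (simpleRoot j)
    rw [hc, hc, map_smul, map_smul, LinearMap.smul_apply, smul_eq_mul, smul_eq_mul, ← mul_assoc,
      mul_comm (c j), mul_left_eq_self₀] at h
    exact h.resolve_right hij
  have hsq (i : Fin n) : c i * c i = 1 := hmul i i (by simp [coxForm_simpleRoot_same])
  have hconst (i j : Fin n) : c i = c j := by
    obtain ⟨path⟩ := hM i j
    induction path with
    | nil => rfl
    | @cons u v w hadj _ ih =>
      rw [← ih]
      have h := hmul _ _ (coxForm_simpleRoot_ne_zero_of_adj hadj)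
      exact mul_right_cancel₀ (right_ne_zero_of_mul_eq_one h) (h.trans (hsq v).symm)
  by_cases hneg : ∃ k, c k = -1
  · obtain ⟨k, hk⟩ := hneg
    exact .inr fun i => by rw [hc, hconst i k, hk, neg_one_smul]
  · refine .inl (Subtype.ext (eq_one_of_simpleRoot_nonneg g.2 fun i => ?_))
    rw [hc, (mul_self_eq_one_iff.1 (hsq i)).resolve_right fun h => hneg ⟨i, h⟩, one_smul]
    exact simpleRoot_nonneg i

variable {w₀ : (Fin n → ℝ) ≃ₗ[ℝ] (Fin n → ℝ)} {σ : Equiv.Perm (Fin n)}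

theorem IsOpposition.map_eq_neg (h : IsOpposition M w₀ 1) (v : Fin n → ℝ) : w₀ v = -v := by
  conv_lhs => rw [eq_sum_smul_simpleRoot v]
  conv_rhs => rw [eq_sum_smul_simpleRoot v]
  rw [map_sum, ← Finset.sum_neg_distrib]
  exact Finset.sum_congr rfl fun i _ => by
    rw [map_smul, h.map_simpleRoot, Equiv.Perm.one_apply, smul_neg]

theorem IsOpposition.center_eq_bot_iff (h : IsOpposition M w₀ σ)
    (hM : (coxeterGraph M).Connected) : Subgroup.center (reflGroup M) = ⊥ ↔ σ ≠ 1 := by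
  constructor
  · rintro hbot rfl
    have hmem : ⟨w₀, h.mem⟩ ∈ Subgroup.center (reflGroup M) := by
      refine Subgroup.mem_center_iff.2 fun g => Subtype.ext (LinearEquiv.ext fun v => ?_)
      simp [h.map_eq_neg]
    rw [hbot, Subgroup.mem_bot] at hmem
    obtain rfl : w₀ = 1 := congrArg Subtype.val hmem
    obtain ⟨i⟩ := hM.nonempty
    have hi : simpleRoot i = -simpleRoot i := h.map_eq_neg (simpleRoot i)
    exact simpleRoot_ne_zero i (self_eq_neg.1 hi)
  · intro hσ
    rw [Subgroup.eq_bot_iff_forall]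
    intro g hg
    refine (eq_one_or_eq_neg_one_of_mem_center hM.preconnected hg).resolve_right fun hneg => hσ ?_
    have h₁ := eq_one_of_simpleRoot_nonneg (mul_mem h.mem g.2) fun i => by
      simp [hneg, h.map_simpleRoot, simpleRoot_nonneg]
    ext1 i
    apply simpleRoot_injective (n := n)
    have := congrArg (fun f => f (simpleRoot i)) h₁
    simpa [hneg, h.map_simpleRoot] using this

end Centre

section PathGraph

variable {n : ℕ} {σ : Equiv.Perm (Fin n)}

theorem exists_forall_perm_eq_add_mul_of_pathGraph_adj (hn : 1 < n)
    (hσ : ∀ i j, (SimpleGraph.pathGraph n).Adj i j → (SimpleGraph.pathGraph n).Adj (σ i) (σ j)) :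
    ∃ a e : ℤ, (e = 1 ∨ e = -1) ∧ ∀ i, (σ i : ℤ) = a + i * e := by
  have hstep (k : ℕ) (hk : k + 1 < n) :
      (σ ⟨k + 1, hk⟩ : ℤ) - σ ⟨k, by omega⟩ = 1 ∨ (σ ⟨k + 1, hk⟩ : ℤ) - σ ⟨k, by omega⟩ = -1 := by
    have := SimpleGraph.pathGraph_adj.1 (hσ ⟨k, by omega⟩ ⟨k + 1, hk⟩
      (SimpleGraph.pathGraph_adj.2 (.inl rfl)))
    omega
  obtain ⟨e, he⟩ : ∃ e : ℤ, (σ ⟨0 + 1, hn⟩ : ℤ) - σ ⟨0, by omega⟩ = e := ⟨_, rfl⟩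
  -- Two consecutive steps have the same direction, as otherwise `σ (k + 2) = σ k`.
  have hconst (k : ℕ) (hk : k + 1 < n) : (σ ⟨k + 1, hk⟩ : ℤ) - σ ⟨k, by omega⟩ = e := by
    induction k with
    | zero => exact he
    | succ k ih =>
      have hne : (σ ⟨k + 1 + 1, hk⟩ : ℕ) ≠ σ ⟨k, by omega⟩ := by
        rw [Ne, Fin.val_inj, σ.injective.eq_iff, Fin.mk.injEq]
        omega
      have h₁ := hstep k (by omega)
      have h₂ := hstep (k + 1) hk
      have h₃ := ih (by omega)
      omega
  refine ⟨σ ⟨0, by omega⟩, e, he ▸ hstep 0 hn, fun ⟨k, hk⟩ => ?_⟩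
  induction k with
  | zero => simp
  | succ k ih =>
    push_cast
    linear_combination hconst k hk + ih (by omega)

theorem eq_one_or_eq_revPerm_of_pathGraph_adj
    (hσ : ∀ i j, (SimpleGraph.pathGraph n).Adj i j → (SimpleGraph.pathGraph n).Adj (σ i) (σ j)) :
    σ = 1 ∨ σ = Fin.revPerm := by
  obtain hn | hn := le_or_gt n 1
  · have := Fin.subsingleton_iff_le_one.2 hn
    exact .inl (Subsingleton.elim _ _)
  obtain ⟨a, e, he, hσ⟩ := exists_forall_perm_eq_add_mul_of_pathGraph_adj hn hσ
  have hfirst : (σ ⟨0, by omega⟩ : ℤ) = a + (0 : ℕ) * e := hσ _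
  have hlast : (σ ⟨n - 1, by omega⟩ : ℤ) = a + (n - 1 : ℕ) * e := hσ _
  obtain rfl | rfl := he
  · refine .inl (Equiv.ext fun i => Fin.ext ?_)
    have := hσ i
    simp only [Equiv.Perm.one_apply]
    omega
  · refine .inr (Equiv.ext fun i => Fin.ext ?_)
    have := hσ i
    simp only [Fin.revPerm_apply, Fin.val_rev]
    omega

theorem IsOpposition.eq_one_or_eq_revPerm {M : CoxeterMatrix (Fin n)}
    {w₀ : (Fin n → ℝ) ≃ₗ[ℝ] (Fin n → ℝ)} (h : IsOpposition M w₀ σ)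
    (hM : coxeterGraph M = SimpleGraph.pathGraph n) : σ = 1 ∨ σ = Fin.revPerm := by
  refine eq_one_or_eq_revPerm_of_pathGraph_adj fun i j hij => ?_
  rw [← hM] at hij ⊢
  exact ⟨σ.injective.ne hij.1, by rw [h.coxeterMatrix_apply]; exact hij.2⟩

theorem IsOpposition.eq_image_iff {M : CoxeterMatrix (Fin n)} [Nonempty (Fin n)]
    {w₀ : (Fin n → ℝ) ≃ₗ[ℝ] (Fin n → ℝ)} (h : IsOpposition M w₀ σ)
    (hM : coxeterGraph M = SimpleGraph.pathGraph n) (I J : Finset (Fin n)) :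
    I = J.image σ ↔ (Subgroup.center (reflGroup M) ≠ ⊥ ∧ I = J) ∨
      (Subgroup.center (reflGroup M) = ⊥ ∧ I = dualSet J) := by
  have hconn : (coxeterGraph M).Connected := ⟨hM ▸ SimpleGraph.pathGraph_preconnected n⟩
  rw [Ne, h.center_eq_bot_iff hconn, not_not]
  by_cases hσ : σ = 1
  · simp [hσ]
  · obtain rfl := (h.eq_one_or_eq_revPerm hM).resolve_left hσ
    simp only [hσ, false_and, false_or, not_false_eq_true, true_and, ne_eq]
    rfl

end PathGraph

section Univalence

variable {V : Type*} [AddCommGroup V] [Module ℝ V] {G : Subgroup (V ≃ₗ[ℝ] V)} {u : V ≃ₗ[ℝ] V}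
  {a : V} {x : Sym2 V}

/-- The endpoint `a` of `x` belongs to no strut generated by `x` other than `x` itself. -/
def IsUnivalent (G : Subgroup (V ≃ₗ[ℝ] V)) (a : V) (x : Sym2 V) : Prop :=
  a ∈ x ∧ ∀ r ∈ G, a ∈ x.map r → x.map r = x

theorem mem_generated_self (G : Subgroup (V ≃ₗ[ℝ] V)) (x : Sym2 V) : x ∈ generated G x :=
  ⟨1, one_mem G, (congrFun Sym2.map_id x).symm⟩

theorem hasUnivalentEndpoint_iff : HasUnivalentEndpoint G x ↔ ∃ a, IsUnivalent G a x := by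
  refine exists_congr fun a => and_congr_right fun ha => ?_
  have hx : x ∈ {y ∈ generated G x | a ∈ y} := ⟨mem_generated_self G x, ha⟩
  constructor
  · intro h r hr har
    exact Set.encard_le_one_iff.1 h.le _ _ ⟨⟨r, hr, rfl⟩, har⟩ hx
  · intro h
    refine Set.encard_eq_one.2 ⟨x, Set.eq_singleton_iff_unique_mem.2 ⟨hx, ?_⟩⟩
    rintro _ ⟨⟨r, hr, rfl⟩, har⟩
    exact h r hr har

theorem sym2_map_mul (r u : V ≃ₗ[ℝ] V) (x : Sym2 V) : x.map (r * u) = (x.map u).map r := by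
  rw [Sym2.map_map]
  rfl

theorem generated_map_eq (hu : u ∈ G) (x : Sym2 V) : generated G (x.map u) = generated G x := by
  ext y
  constructor
  · rintro ⟨r, hr, rfl⟩
    exact ⟨r * u, mul_mem hr hu, (sym2_map_mul r u x).symm⟩
  · rintro ⟨r, hr, rfl⟩
    exact ⟨r * u⁻¹, mul_mem hr (inv_mem hu), by rw [← sym2_map_mul, inv_mul_cancel_right]⟩

theorem IsUnivalent.map (h : IsUnivalent G a x) (hu : u ∈ Subgroup.normalizer (G : Set _)) :
    IsUnivalent G (u a) (x.map u) := by
  refine ⟨Sym2.mem_map.2 ⟨a, h.1, rfl⟩, fun r hr har => ?_⟩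
  have hru : r * u = u * (u⁻¹ * r * u) := by group
  rw [← sym2_map_mul, hru, sym2_map_mul] at har ⊢
  obtain ⟨b, hb, hba⟩ := Sym2.mem_map.1 har
  rw [h.2 _ ((Subgroup.mem_normalizer_iff''.1 hu r).1 hr) (u.injective hba ▸ hb)]

theorem hasUnivalentEndpoint_map_iff (hu : u ∈ Subgroup.normalizer (G : Set _)) :
    HasUnivalentEndpoint G (x.map u) ↔ HasUnivalentEndpoint G x := by
  rw [hasUnivalentEndpoint_iff, hasUnivalentEndpoint_iff]
  constructor
  · rintro ⟨a, ha⟩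
    refine ⟨u⁻¹ a, ?_⟩
    have := ha.map (inv_mem hu)
    rwa [← sym2_map_mul, inv_mul_cancel, LinearEquiv.coe_one, Sym2.map_id] at this
  · rintro ⟨a, ha⟩
    exact ⟨u a, ha.map hu⟩

end Univalence

section Struts

variable {n : ℕ} {M : CoxeterMatrix (Fin n)} {I J : Finset (Fin n)} {p q v : Fin n → ℝ}
  {g : (Fin n → ℝ) ≃ₗ[ℝ] (Fin n → ℝ)} {G : Subgroup ((Fin n → ℝ) ≃ₗ[ℝ] (Fin n → ℝ))} {t : ℝ}

theorem rotGroup_le_reflGroup (M : CoxeterMatrix (Fin n)) : rotGroup M ≤ reflGroup M :=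
  inf_le_left

theorem reflGroup_le_normalizer_rotGroup (M : CoxeterMatrix (Fin n)) :
    reflGroup M ≤ Subgroup.normalizer (rotGroup M : Set _) := by
  refine le_trans (le_inf Subgroup.le_normalizer ?_) Subgroup.inf_normalizer_le_normalizer_inf
  rw [Subgroup.normalizer_eq_top]
  exact le_top

theorem le_reflGroup_and_reflGroup_le_normalizer (hG : G = reflGroup M ∨ G = rotGroup M) :
    G ≤ reflGroup M ∧ reflGroup M ≤ Subgroup.normalizer (G : Set _) := by
  obtain rfl | rfl := hG
  · exact ⟨le_rfl, Subgroup.le_normalizer⟩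
  · exact ⟨rotGroup_le_reflGroup M, reflGroup_le_normalizer_rotGroup M⟩

theorem coxForm_eq_zero_of_simpleRefl_eq {i : Fin n} (h : simpleRefl M i v = v) :
    coxForm M (simpleRoot i) v = 0 := by
  rw [simpleRefl_apply, sub_eq_self, smul_eq_zero_iff_left (simpleRoot_ne_zero i)] at h
  simpa using h

theorem coxForm_eq_zero_of_simpleRefl_mul_eq {i j : Fin n} (hij : i ≠ j)
    (h : (simpleRefl M i * simpleRefl M j) v = v) : coxForm M (simpleRoot i) v = 0 := by
  have h' : simpleRefl M j v = simpleRefl M i v := by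
    have := congrArg (simpleRefl M i) h
    rwa [← LinearEquiv.mul_apply, ← mul_assoc, simpleRefl_mul_self, one_mul] at this
  have := congrFun h' i
  rw [simpleRefl_apply, simpleRefl_apply] at this
  simpa [simpleRoot, hij] using this.symm

theorem IsUnivalent.map_eq_self {a b : Fin n → ℝ} {r : (Fin n → ℝ) ≃ₗ[ℝ] (Fin n → ℝ)}
    (h : IsUnivalent G a s(a, b)) (hr : r ∈ G) (ha : r a = a) : r b = b := by
  have := h.2 r hr (by rw [Sym2.map_mk, ha]; exact Sym2.mem_mk_left a _)
  rwa [Sym2.map_mk, ha, Sym2.congr_right] at this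

theorem exists_eq_smul_of_isUnivalent_reflGroup [Finite (reflGroup M)] (hI : I.card + 1 = n)
    (hp : p ∈ facet M I) (h : IsUnivalent (reflGroup M) p s(p, v)) : ∃ t : ℝ, v = t • p :=
  exists_eq_smul_of_mem_facet hI hp fun i hi => coxForm_eq_zero_of_simpleRefl_eq <|
    h.map_eq_self (simpleRefl_mem M i) (simpleRefl_apply_of_mem_facet hp hi)

theorem exists_eq_smul_of_isUnivalent_rotGroup [Finite (reflGroup M)] (hn : 3 ≤ n)
    (hI : I.card + 1 = n) (hp : p ∈ facet M I) (h : IsUnivalent (rotGroup M) p s(p, v)) :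
    ∃ t : ℝ, v = t • p := by
  refine exists_eq_smul_of_mem_facet hI hp fun i hi => ?_
  obtain ⟨j, hj, hji⟩ := Finset.exists_mem_ne (show 1 < I.card by omega) i
  have hrot : simpleRefl M i * simpleRefl M j ∈ rotGroup M := by
    refine ⟨mul_mem (simpleRefl_mem M i) (simpleRefl_mem M j), ?_⟩
    simp [det_simpleRefl]
  refine coxForm_eq_zero_of_simpleRefl_mul_eq hji.symm (h.map_eq_self hrot ?_)
  rw [LinearEquiv.mul_apply, simpleRefl_apply_of_mem_facet hp hj,
    simpleRefl_apply_of_mem_facet hp hi]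

theorem exists_map_add_inv_map_eq_smul {g : (Fin 2 → ℝ) ≃ₗ[ℝ] (Fin 2 → ℝ)}
    (hg : LinearEquiv.det g = 1) : ∃ t : ℝ, ∀ v, g v + g⁻¹ v = t • v := by
  -- Cayley-Hamilton: `g² - (tr g) g + 1 = 0`.
  set A := LinearMap.toMatrix' g.toLinearMap
  have hA (v : Fin 2 → ℝ) : g v = A.mulVec v := (LinearMap.toMatrix'_mulVec _ v).symm
  have hdet : A 0 0 * A 1 1 - A 0 1 * A 1 0 = 1 := by
    rw [← Matrix.det_fin_two, LinearMap.det_toMatrix', ← LinearEquiv.coe_det, hg, Units.val_one]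
  refine ⟨A 0 0 + A 1 1, fun v => g.injective ?_⟩
  rw [map_add, ← LinearEquiv.mul_apply g g⁻¹, mul_inv_cancel, LinearEquiv.coe_one, id, map_smul,
    hA, hA]
  ext i
  fin_cases i <;>
    simp only [Matrix.mulVec, dotProduct, Fin.sum_univ_two, Pi.add_apply, Pi.smul_apply,
      smul_eq_mul, Fin.zero_eta, Fin.mk_one]
  · linear_combination (-v 0) * hdet
  · linear_combination (-v 1) * hdet

theorem exists_mem_rotGroup_map_eq {i : Fin n} (hi : simpleRefl M i p = p)
    (hg : g ∈ reflGroup M) : ∃ r ∈ rotGroup M, r p = g p := by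
  obtain hdet | hdet := det_of_mem hg
  · exact ⟨g, ⟨hg, hdet⟩, rfl⟩
  · refine ⟨g * simpleRefl M i, ⟨mul_mem hg (simpleRefl_mem M i), ?_⟩, ?_⟩
    · simp [hdet, det_simpleRefl]
    · rw [LinearEquiv.mul_apply, hi]

theorem exists_map_eq_smul_of_isUnivalent_rotGroup_two {M : CoxeterMatrix (Fin 2)}
    {p : Fin 2 → ℝ} {r : (Fin 2 → ℝ) ≃ₗ[ℝ] (Fin 2 → ℝ)} (hr : r ∈ rotGroup M)
    (h : IsUnivalent (rotGroup M) p s(p, r p)) : ∃ t : ℝ, r p = t • p := by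
  have hmap : s(p, r p).map (r⁻¹ : (Fin 2 → ℝ) ≃ₗ[ℝ] (Fin 2 → ℝ)) = s(p, r⁻¹ p) := by
    rw [Sym2.map_mk, ← LinearEquiv.mul_apply r⁻¹ r, inv_mul_cancel, LinearEquiv.coe_one, id,
      Sym2.eq_swap]
  have hinv : r⁻¹ p = r p := by
    have := h.2 r⁻¹ (inv_mem hr) (hmap ▸ Sym2.mem_mk_left _ _)
    rwa [hmap, Sym2.congr_right] at this
  obtain ⟨t, ht⟩ := exists_map_add_inv_map_eq_smul hr.2
  refine ⟨(1 / 2) * t, ?_⟩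
  have htp := ht p
  rw [hinv] at htp
  linear_combination (norm := module) (1 / 2 : ℝ) • htp

theorem exists_map_eq_smul_of_isUnivalent_rotGroup [Finite (reflGroup M)] (hI : I.card + 1 = n)
    (hp : p ∈ facet M I) (hg : g ∈ reflGroup M) (h : IsUnivalent (rotGroup M) p s(p, g p)) :
    ∃ t : ℝ, g p = t • p := by
  obtain hn | hn := le_or_gt 3 n
  · exact exists_eq_smul_of_isUnivalent_rotGroup hn hI hp h
  obtain rfl | ⟨i, hi⟩ := I.eq_empty_or_nonempty
  · exact exists_eq_smul_of_mem_facet hI hp (by simp)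
  obtain rfl : n = 2 := by
    have := Finset.card_pos.2 ⟨i, hi⟩
    omega
  obtain ⟨r, hr, hrg⟩ := exists_mem_rotGroup_map_eq (simpleRefl_apply_of_mem_facet hp hi) hg
  rw [← hrg] at h ⊢
  exact exists_map_eq_smul_of_isUnivalent_rotGroup_two hr h

theorem exists_map_eq_smul_of_isUnivalent [Finite (reflGroup M)] (hI : I.card + 1 = n)
    (hp : p ∈ facet M I) (hpq : I = J → p = q)
    (hG : G = reflGroup M ∨ (G = rotGroup M ∧ (3 ≤ n ∨ I = J))) (hg : g ∈ reflGroup M)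
    (h : IsUnivalent G p s(p, g q)) : ∃ t : ℝ, g q = t • p := by
  obtain rfl | ⟨rfl, hn | hIJ⟩ := hG
  · exact exists_eq_smul_of_isUnivalent_reflGroup hI hp h
  · exact exists_eq_smul_of_isUnivalent_rotGroup hn hI hp h
  · obtain rfl := hpq hIJ
    exact exists_map_eq_smul_of_isUnivalent_rotGroup hI hp hg h

theorem exists_map_eq_neg_smul_of_isUnivalent [Finite (reflGroup M)] (hI : I.card + 1 = n)
    (hJ : J.card + 1 = n) (hp : p ∈ facet M I) (hq : q ∈ facet M J) (hpq : I = J → p = q)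
    (hG : G = reflGroup M ∨ (G = rotGroup M ∧ (3 ≤ n ∨ I = J))) (hg : g ∈ reflGroup M)
    (hne : p ≠ g q) (h : IsUnivalent G p s(p, g q)) : ∃ t < (0 : ℝ), g q = t • p := by
  obtain ⟨t, ht⟩ := exists_map_eq_smul_of_isUnivalent hI hp hpq hG hg h
  refine ⟨t, lt_of_not_ge fun h₀ => ?_, ht⟩
  obtain rfl | hpos := h₀.eq_or_lt
  · rw [zero_smul, LinearEquiv.map_eq_zero_iff] at ht
    exact ne_zero_of_mem_facet hJ hq ht
  · have hqp := eq_smul_of_map_eq_smul hg hp hq hpos ht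
    have hIJ := eq_of_mem_facet (hqp ▸ smul_mem_facet hp hpos) hq
    rw [ht, ← hqp] at hne
    exact hne (hpq hIJ)

theorem eq_one_of_map_eq_smul (hI : I.card + 1 = n) (hp : p ∈ facet M I) (hg : g ∈ reflGroup M)
    (ht : 0 < t) (h : g p = t • p) : t = 1 := by
  have := eq_smul_of_map_eq_smul hg hp hp ht h
  exact (smul_left_injective ℝ (ne_zero_of_mem_facet hI hp) ((one_smul ℝ p).trans this)).symm

theorem isUnivalent_neg_smul (hI : I.card + 1 = n) (hp : p ∈ facet M I) (hG : G ≤ reflGroup M)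
    (ht : t < 0) : IsUnivalent G p s(p, t • p) := by
  refine ⟨Sym2.mem_mk_left _ _, fun r hr har => ?_⟩
  rw [Sym2.map_mk, map_smul] at har ⊢
  obtain hrp | hrp := Sym2.mem_iff.1 har
  · rw [← hrp]
  have hinv : r p = t⁻¹ • p := (inv_smul_eq_iff₀ ht.ne).2 hrp |>.symm
  -- `r²` multiplies `p` by the positive number `t⁻²`, which therefore is `1`.
  have hsq : t⁻¹ * t⁻¹ = 1 := by
    refine eq_one_of_map_eq_smul hI hp (hG (mul_mem hr hr))
      (mul_pos_of_neg_of_neg (inv_lt_zero.2 ht) (inv_lt_zero.2 ht)) ?_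
    rw [LinearEquiv.mul_apply, hinv, map_smul, hinv, smul_smul]
  rw [← hrp, hinv, ← inv_eq_of_mul_eq_one_left hsq, inv_inv, Sym2.eq_swap]

theorem hasUnivalentEndpoint_iff_exists_map_eq_neg_smul [Finite (reflGroup M)]
    (hI : I.card + 1 = n) (hJ : J.card + 1 = n) (hp : p ∈ facet M I) (hq : q ∈ facet M J)
    (hpq : I = J → p = q) (hG : G = reflGroup M ∨ (G = rotGroup M ∧ (3 ≤ n ∨ I = J)))
    (hg : g ∈ reflGroup M) (hne : p ≠ g q) :
    HasUnivalentEndpoint G s(p, g q) ↔ ∃ t < (0 : ℝ), g q = t • p := by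
  obtain ⟨hle, hnorm⟩ := le_reflGroup_and_reflGroup_le_normalizer (hG.imp_right And.left)
  rw [hasUnivalentEndpoint_iff]
  constructor
  · rintro ⟨a, ha⟩
    obtain rfl | rfl := Sym2.mem_iff.1 ha.1
    · exact exists_map_eq_neg_smul_of_isUnivalent hI hJ hp hq hpq hG hg hne ha
    · have ha' := ha.map (hnorm (inv_mem hg))
      rw [Sym2.map_mk, show g⁻¹ (g q) = q from g.symm_apply_apply q, Sym2.eq_swap] at ha'
      obtain ⟨t, ht, htp⟩ := exists_map_eq_neg_smul_of_isUnivalent hJ hI hq hp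
        (fun h => (hpq h.symm).symm) (hG.imp_right (And.imp_right (Or.imp_right Eq.symm)))
        (inv_mem hg) (fun h => hne (g.symm_apply_eq.1 h.symm)) ha'
      refine ⟨t⁻¹, inv_lt_zero.2 ht, ?_⟩
      rw [eq_inv_smul_iff₀ ht.ne, ← map_smul]
      exact (g.symm_apply_eq.1 htp).symm
  · rintro ⟨t, ht, hgq⟩
    exact ⟨p, hgq ▸ isUnivalent_neg_smul hI hp hle ht⟩

theorem exists_map_eq_of_isStrut {x : Sym2 (Fin n → ℝ)} (hx : IsStrut M p q x) :
    ∃ u ∈ reflGroup M, ∃ g ∈ reflGroup M, p ≠ g q ∧ x = s(p, g q).map u := by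
  obtain ⟨u, hu, w, hw, hne, rfl⟩ := hx
  have huw : u ((u⁻¹ * w) q) = w q := u.apply_symm_apply (w q)
  refine ⟨u, hu, u⁻¹ * w, mul_mem (inv_mem hu) hw, fun h => hne (h ▸ huw), ?_⟩
  rw [Sym2.map_mk, huw]

theorem isStrut_mk (hg : g ∈ reflGroup M) (hne : p ≠ g q) : IsStrut M p q s(p, g q) :=
  ⟨1, one_mem _, g, hg, hne, rfl⟩

theorem ne_map_of_map_eq_neg_smul (hI : I.card + 1 = n) (hp : p ∈ facet M I) (ht : t < 0)
    (h : g q = t • p) : p ≠ g q := by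
  rw [h]
  intro hpt
  have h₁ := smul_left_injective ℝ (ne_zero_of_mem_facet hI hp) ((one_smul ℝ p).trans hpt)
  linarith

theorem setOf_generated_eq [Finite (reflGroup M)] (hI : I.card + 1 = n) (hJ : J.card + 1 = n)
    (hp : p ∈ facet M I) (hq : q ∈ facet M J) (hpq : I = J → p = q)
    (hG : G = reflGroup M ∨ (G = rotGroup M ∧ (3 ≤ n ∨ I = J))) :
    {O | ∃ x, IsStrut M p q x ∧ HasUnivalentEndpoint G x ∧ O = generated (reflGroup M) x} =
      {O | ∃ g ∈ reflGroup M, ∃ t < (0 : ℝ), g q = t • p ∧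
        O = generated (reflGroup M) s(p, g q)} := by
  ext O
  constructor
  · rintro ⟨x, hx, hxuniv, rfl⟩
    obtain ⟨u, hu, g, hg, hne, rfl⟩ := exists_map_eq_of_isStrut hx
    have hnorm := (le_reflGroup_and_reflGroup_le_normalizer (hG.imp_right And.left)).2
    rw [hasUnivalentEndpoint_map_iff (hnorm hu),
      hasUnivalentEndpoint_iff_exists_map_eq_neg_smul hI hJ hp hq hpq hG hg hne] at hxuniv
    obtain ⟨t, ht, hgq⟩ := hxuniv
    exact ⟨g, hg, t, ht, hgq, generated_map_eq hu _⟩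
  · rintro ⟨g, hg, t, ht, hgq, rfl⟩
    have hne := ne_map_of_map_eq_neg_smul hI hp ht hgq
    exact ⟨s(p, g q), isStrut_mk hg hne,
      (hasUnivalentEndpoint_iff_exists_map_eq_neg_smul hI hJ hp hq hpq hG hg hne).2
        ⟨t, ht, hgq⟩, rfl⟩

theorem eq_of_map_eq_neg_smul {g' : (Fin n → ℝ) ≃ₗ[ℝ] (Fin n → ℝ)} {t' : ℝ}
    (hI : I.card + 1 = n) (hp : p ∈ facet M I) (hg : g ∈ reflGroup M) (hg' : g' ∈ reflGroup M)
    (ht : t < 0) (ht' : t' < 0) (h : g q = t • p) (h' : g' q = t' • p) : t' = t := by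
  have hq : g⁻¹ p = t⁻¹ • q := by
    rw [eq_inv_smul_iff₀ ht.ne, ← map_smul, ← h]
    exact g.symm_apply_apply q
  have h₁ := eq_one_of_map_eq_smul (t := t⁻¹ * t') hI hp (mul_mem hg' (inv_mem hg))
    (mul_pos_of_neg_of_neg (inv_lt_zero.2 ht) ht')
    (by rw [LinearEquiv.mul_apply, hq, map_smul, h', smul_smul])
  exact ((inv_mul_eq_one₀ ht.ne).1 h₁).symm

theorem numUnivalent_eq_one [Finite (reflGroup M)] (hI : I.card + 1 = n) (hJ : J.card + 1 = n)
    (hp : p ∈ facet M I) (hq : q ∈ facet M J) (hpq : I = J → p = q)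
    (hG : G = reflGroup M ∨ (G = rotGroup M ∧ (3 ≤ n ∨ I = J)))
    (h : ∃ g ∈ reflGroup M, ∃ t < (0 : ℝ), g q = t • p) : numUnivalent M G p q = 1 := by
  obtain ⟨g, hg, t, ht, hgq⟩ := h
  rw [numUnivalent, setOf_generated_eq hI hJ hp hq hpq hG, Set.encard_eq_one]
  refine ⟨generated (reflGroup M) s(p, g q), Set.eq_singleton_iff_unique_mem.2
    ⟨⟨g, hg, t, ht, hgq, rfl⟩, ?_⟩⟩
  rintro _ ⟨g', hg', t', ht', hgq', rfl⟩
  rw [hgq', hgq, eq_of_map_eq_neg_smul hI hp hg hg' ht ht' hgq hgq']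

theorem numUnivalent_eq_zero [Finite (reflGroup M)] (hI : I.card + 1 = n) (hJ : J.card + 1 = n)
    (hp : p ∈ facet M I) (hq : q ∈ facet M J) (hpq : I = J → p = q)
    (hG : G = reflGroup M ∨ (G = rotGroup M ∧ (3 ≤ n ∨ I = J)))
    (h : ¬∃ g ∈ reflGroup M, ∃ t < (0 : ℝ), g q = t • p) : numUnivalent M G p q = 0 := by
  rw [numUnivalent, setOf_generated_eq hI hJ hp hq hpq hG, Set.encard_eq_zero,
    Set.eq_empty_iff_forall_notMem]
  rintro _ ⟨g, hg, t, ht, hgq, -⟩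
  exact h ⟨g, hg, t, ht, hgq⟩

end Struts

section Finiteness

variable {n : ℕ} {M : CoxeterMatrix (Fin n)} {ι : Type*}

theorem dotProduct_simpleRefl (M : CoxeterMatrix (Fin n)) (i : Fin n) (f v : Fin n → ℝ) :
    f ⬝ᵥ simpleRefl M i v =
      (fun j => f j + 2 * Real.cos (Real.pi / M i j) * f i) ⬝ᵥ v := by
  rw [simpleRefl_apply, dotProduct_sub, dotProduct_smul, coxForm_simpleRoot_left, simpleRoot,
    dotProduct_single_one]
  simp only [dotProduct, smul_eq_mul, Finset.mul_sum, Finset.sum_mul, ← Finset.sum_sub_distrib]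
  exact Finset.sum_congr rfl fun j _ => by ring

theorem exists_dotProduct_geomRep_eq_unit_mul {F : ι → Fin n → ℝ}
    (hF : ∀ i a, ∃ b, ∃ ε : ℤˣ, ∀ j,
      F a j + 2 * Real.cos (Real.pi / M i j) * F a i = (ε : ℤ) * F b j) (w : M.Group) (a : ι) :
    ∃ b, ∃ ε : ℤˣ, ∀ v, F a ⬝ᵥ geomRep M w v = (ε : ℤ) * (F b ⬝ᵥ v) := by
  induction w using M.toCoxeterSystem.simple_induction_left generalizing a with
  | one => exact ⟨a, 1, fun v => by simp⟩
  | mul_simple_left w i ih =>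
    obtain ⟨b, ε, hb⟩ := hF i a
    obtain ⟨c, δ, hc⟩ := ih b
    refine ⟨c, ε * δ, fun v => ?_⟩
    calc F a ⬝ᵥ geomRep M (M.toCoxeterSystem.simple i * w) v
        = F a ⬝ᵥ simpleRefl M i (geomRep M w v) := by
          rw [map_mul, LinearEquiv.mul_apply, geomRep_simple]
      _ = ((ε : ℤ) : ℝ) • F b ⬝ᵥ geomRep M w v := by
          rw [dotProduct_simpleRefl]
          exact congrArg (· ⬝ᵥ _) (funext hb)
      _ = ((ε * δ : ℤˣ) : ℤ) * (F c ⬝ᵥ v) := by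
          rw [smul_dotProduct, hc, smul_eq_mul, Units.val_mul, Int.cast_mul, mul_assoc]

theorem eq_zero_of_forall_dotProduct_eq_zero {F : Fin n → Fin n → ℝ}
    (hlt : ∀ k j, k < j → F k j = 0) (hdiag : ∀ k, F k k ≠ 0) {v : Fin n → ℝ}
    (hv : ∀ k, F k ⬝ᵥ v = 0) : v = 0 := by
  refine Matrix.eq_zero_of_mulVec_eq_zero (M := Matrix.of F) ?_ (funext hv)
  rw [Matrix.det_of_isLowerTriangular (Matrix.of F) fun k j h => hlt k j h]
  exact Finset.prod_ne_zero_iff.2 fun k _ => hdiag k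

theorem finite_reflGroup_of_lowerTriangular [Finite ι] {F : ι → Fin n → ℝ} {r : Fin n → ι}
    (hlt : ∀ k j, k < j → F (r k) j = 0) (hdiag : ∀ k, F (r k) k ≠ 0)
    (hF : ∀ i a, ∃ b, ∃ ε : ℤˣ, ∀ j,
      F a j + 2 * Real.cos (Real.pi / M i j) * F a i = (ε : ℤ) * F b j) :
    Finite (reflGroup M) := by
  have permuted_up_to_sign : ∀ (g : reflGroup M) (a : ι), ∃ b, ∃ ε : ℤˣ,
      ∀ v, F a ⬝ᵥ g.1 v = (ε : ℤ) * (F b ⬝ᵥ v) := by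
    rintro ⟨g, hg⟩ a
    obtain ⟨w, rfl⟩ := (range_geomRep M).symm ▸ hg
    exact exists_dotProduct_geomRep_eq_unit_mul hF w a
  choose b ε hb using permuted_up_to_sign
  refine Finite.of_injective (fun g a => (b g a, ε g a)) fun g g' hgg' => ?_
  ext1
  ext1 v
  refine sub_eq_zero.1 (eq_zero_of_forall_dotProduct_eq_zero (F := F ∘ r) hlt hdiag fun k => ?_)
  obtain ⟨hbk, hεk⟩ := Prod.ext_iff.1 (congrFun hgg' (r k))
  rw [Function.comp_apply, dotProduct_sub, hb, hb, sub_eq_zero]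
  exact congrArg₂ (fun (ε : ℤˣ) b => (ε : ℤ) * (F b ⬝ᵥ v)) hεk hbk

end Finiteness

section Families

theorem two_mul_cos_A {n : ℕ} (i j : Fin n) : 2 * Real.cos (Real.pi / CoxeterMatrix.A n i j) =
    if i = j then -2 else if (j : ℕ) + 1 = i ∨ (i : ℕ) + 1 = j then 1 else 0 := by
  simp only [CoxeterMatrix.A, Matrix.of_apply]
  split_ifs <;> norm_num

theorem finite_reflGroup_A (n : ℕ) : Finite (reflGroup (CoxeterMatrix.A n)) := by
  -- The standard coordinates of `ℝ ^ (n + 1)`, in which `α_i = e_i - e_{i + 1}`.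
  refine finite_reflGroup_of_lowerTriangular (ι := Fin (n + 1)) (r := Fin.castSucc)
    (F := fun a j => (if (a : ℕ) = j then 1 else 0) - if (a : ℕ) = j + 1 then 1 else 0)
    (fun k j hkj => ?_) (fun k => ?_) fun i a =>
      ⟨Equiv.swap i.castSucc i.succ a, 1, fun j => ?_⟩
  · grind
  · simp
  · simp only [two_mul_cos_A, Equiv.swap_apply_def, Units.val_one, Int.cast_one]
    grind

theorem two_mul_cos_B {n : ℕ} (i j : Fin n) : 2 * Real.cos (Real.pi / CoxeterMatrix.B n i j) =
    if i = j then -2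
    else if (j : ℕ) + 1 = i ∨ (i : ℕ) + 1 = j then
      if (i : ℕ) + 1 = n ∨ (j : ℕ) + 1 = n then √2 else 1
    else 0 := by
  simp only [CoxeterMatrix.B, Matrix.of_apply]
  split_ifs <;> first | grind | norm_num [mul_div_cancel₀]

theorem finite_reflGroup_B (n : ℕ) : Finite (reflGroup (CoxeterMatrix.B n)) := by
  have sqrt_two_mul_self : √2 * √2 = 2 := by norm_num
  -- The standard coordinates, scaled by `√2`, of `α_i = (e_i - e_{i + 1}) / √2` and `α_n = e_n`.
  refine finite_reflGroup_of_lowerTriangular (ι := Fin n) (r := id)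
    (F := fun a j => if a = j then (if (j : ℕ) + 1 = n then √2 else 1)
      else if (a : ℕ) = j + 1 then -1 else 0)
    (fun k j hkj => ?_) (fun k => ?_) fun i a => ?_
  · grind
  · have := Real.sqrt_pos.2 (two_pos (α := ℝ))
    grind
  · simp only [two_mul_cos_B]
    by_cases hi : (i : ℕ) + 1 < n
    · refine ⟨Equiv.swap i ⟨i + 1, hi⟩ a, 1, fun j => ?_⟩
      simp only [Equiv.swap_apply_def, Units.val_one, Int.cast_one]
      grind
    · rcases eq_or_ne a i with rfl | ha
      · refine ⟨a, -1, fun j => ?_⟩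
        simp only [Units.val_neg, Units.val_one, Int.cast_neg, Int.cast_one]
        grind
      · refine ⟨a, 1, fun j => ?_⟩
        simp only [Units.val_one, Int.cast_one]
        grind

theorem finite_reflGroup_I (m : ℕ) : Finite (reflGroup (CoxeterMatrix.I m)) := by
  set θ : ℝ := Real.pi / (m + 2 : ℕ) with hθ
  have hd : (0 : ℝ) < (m + 2 : ℕ) := by positivity
  obtain ⟨s, hs⟩ : ∃ s : ℤ → ℝ, ∀ k, s k = Real.sin (k * θ) := ⟨_, fun _ => rfl⟩
  have s_neg (k : ℤ) : s (-k) = -s k := by simp [hs]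
  have s_one_pos : 0 < s 1 := by
    rw [hs, Int.cast_one, one_mul]
    exact Real.sin_pos_of_pos_of_lt_pi (div_pos Real.pi_pos hd)
      (div_lt_self Real.pi_pos (by exact_mod_cast (by omega : 1 < m + 2)))
  have s_rec (k : ℤ) : s (k + 1) + s (k - 1) = 2 * Real.cos θ * s k := by
    simp only [hs, Int.cast_add, Int.cast_sub, Int.cast_one, add_mul, sub_mul, one_mul,
      Real.sin_add, Real.sin_sub]
    ring
  have s_periodic : Function.Periodic s (2 * (m + 2 : ℕ)) := fun k => by
    have two_pi : 2 * (m + 2 : ℕ) * θ = 2 * Real.pi := by rw [hθ]; field_simp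
    simp only [hs, Int.cast_add, Int.cast_mul, Int.cast_ofNat, Int.cast_natCast, add_mul _ _ θ,
      two_pi, Real.sin_add_two_pi]
  -- The vertices of a regular `2 (m + 2)`-gon, paired with the simple roots.
  set F : ℤ → Fin 2 → ℝ := fun k => ![-s k, s (k + 1)] with hF
  have F_periodic : Function.Periodic F (2 * (m + 2 : ℕ)) := fun k => by
    simp only [hF, s_periodic k, add_right_comm k _ 1, s_periodic (k + 1)]
  have : Finite (Set.range F) := by
    rw [← F_periodic.image_Ioc (by positivity) 0]
    exact (Set.finite_Ioc _ _).image F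
  refine finite_reflGroup_of_lowerTriangular (ι := Set.range F) (F := Subtype.val)
    (r := ![⟨F (-1), -1, rfl⟩, ⟨F 0, 0, rfl⟩]) ?_ ?_ ?_
  · have : s 0 = 0 := by simp [hs]
    simpa [Fin.forall_fin_two, hF]
  · simp [Fin.forall_fin_two, hF, s_neg, s_one_pos.ne']
  · rintro i ⟨_, k, rfl⟩
    refine ⟨⟨F (if i = 0 then -k else -k - 2), _, rfl⟩, 1, ?_⟩
    have := s_rec k
    have := s_rec (k + 1)
    fin_cases i <;> simp [Fin.forall_fin_two, hF, CoxeterMatrix.I] <;> grind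

theorem two_mul_cos_H₃ (i j : Fin 3) : 2 * Real.cos (Real.pi / CoxeterMatrix.H₃ i j) =
    !![-2, 1, 0; 1, -2, Real.goldenRatio; 0, Real.goldenRatio, -2] i j := by
  have cos_five : 2 * Real.cos (Real.pi / 5) = Real.goldenRatio := by
    rw [Real.cos_pi_div_five, Real.goldenRatio]
    ring
  fin_cases i <;> fin_cases j <;>
    simp [CoxeterMatrix.H₃, cos_five, -Real.cos_pi_div_five]

theorem finite_reflGroup_H₃ : Finite (reflGroup CoxeterMatrix.H₃) := by
  obtain ⟨φ, hφ⟩ : ∃ φ, φ = Real.goldenRatio := ⟨_, rfl⟩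
  have φ_ne_zero : φ ≠ 0 := hφ ▸ Real.goldenRatio_ne_zero
  have φ_sq : φ ^ 2 = φ + 1 := hφ ▸ Real.goldenRatio_sq
  -- Six vertices of an icosahedron, one from each antipodal pair, paired with the simple roots.
  let F : Fin 6 → Fin 3 → ℝ :=
    ![![1, 0, 0], ![-1, 1, 0], ![0, -1, φ], ![0, φ, -φ], ![φ, -φ, 1], ![-φ, 0, 1]]
  let b : Fin 3 → Fin 6 → Fin 6 := ![![1, 0, 2, 3, 5, 4], ![0, 2, 1, 4, 3, 5], ![0, 1, 3, 2, 5, 4]]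
  refine finite_reflGroup_of_lowerTriangular (F := F) (r := ![0, 1, 2]) ?_ ?_ fun i a =>
    ⟨b i a, if i = 2 ∧ 4 ≤ a then -1 else 1, ?_⟩
  · simp [Fin.forall_fin_succ, F]
  · simp [Fin.forall_fin_succ, F, φ_ne_zero]
  · simp only [two_mul_cos_H₃, ← hφ]
    fin_cases i <;> fin_cases a <;> simp [Fin.forall_fin_succ, F, b] <;> grind

theorem IsConsidered.finite_reflGroup {n : ℕ} {M : CoxeterMatrix (Fin n)} (hM : IsConsidered M) :
    Finite (reflGroup M) := by
  cases hM with
  | alpha => exact finite_reflGroup_A _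
  | beta => exact finite_reflGroup_B _
  | dih => exact finite_reflGroup_I _
  | icosahedral => exact finite_reflGroup_H₃

theorem IsConsidered.coxeterGraph_eq_pathGraph {n : ℕ} {M : CoxeterMatrix (Fin n)}
    (hM : IsConsidered M) : coxeterGraph M = SimpleGraph.pathGraph n := by
  ext i j
  simp only [SimpleGraph.pathGraph_adj, coxeterGraph]
  cases hM with
  | alpha =>
    simp only [CoxeterMatrix.A, Matrix.of_apply]
    grind
  | beta =>
    simp only [CoxeterMatrix.B, Matrix.of_apply]
    grind
  | dih =>
    simp only [CoxeterMatrix.I, Matrix.of_apply]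
    grind
  | icosahedral => fin_cases i <;> fin_cases j <;> simp [CoxeterMatrix.H₃]

end Families

theorem mainTheorem4_general {n : ℕ} (M : CoxeterMatrix (Fin n)) [Finite (reflGroup M)]
    (hM : coxeterGraph M = SimpleGraph.pathGraph n)
    (I J : Finset (Fin n)) (hI : I.card + 1 = n) (hJ : J.card + 1 = n)
    (p q : Fin n → ℝ) (hp : p ∈ facet M I) (hq : q ∈ facet M J) (hpq : I = J → p = q)
    (G : Subgroup ((Fin n → ℝ) ≃ₗ[ℝ] (Fin n → ℝ)))
    (hG : G = reflGroup M ∨ (G = rotGroup M ∧ (3 ≤ n ∨ I = J))) :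
    (((Subgroup.center (reflGroup M) ≠ ⊥ ∧ I = J) ∨
        (Subgroup.center (reflGroup M) = ⊥ ∧ I = dualSet J)) →
      numUnivalent M G p q = 1) ∧
    (¬ ((Subgroup.center (reflGroup M) ≠ ⊥ ∧ I = J) ∨
        (Subgroup.center (reflGroup M) = ⊥ ∧ I = dualSet J)) →
      numUnivalent M G p q = 0) := by
  obtain ⟨w₀, σ, h⟩ := exists_isOpposition (M := M)
  have : Nonempty (Fin n) := ⟨⟨0, by omega⟩⟩
  rw [← h.eq_image_iff hM, ← h.exists_map_eq_neg_smul_iff hI hp hq]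
  exact ⟨numUnivalent_eq_one hI hJ hp hq hpq hG, numUnivalent_eq_zero hI hJ hp hq hpq hG⟩

theorem mainTheorem4 {n : ℕ} (M : CoxeterMatrix (Fin n)) (hM : IsConsidered M)
    (I J : Finset (Fin n)) (hI : I.card + 1 = n) (hJ : J.card + 1 = n)
    (hI₀ : I.Nonempty) (hJ₀ : J.Nonempty)
    (p q : Fin n → ℝ) (hp : p ∈ facet M I) (hq : q ∈ facet M J) (hpq : I = J → p = q)
    (G : Subgroup ((Fin n → ℝ) ≃ₗ[ℝ] (Fin n → ℝ)))
    (hG : G = reflGroup M ∨ (G = rotGroup M ∧ (3 ≤ n ∨ I = J))) :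
    (((Subgroup.center (reflGroup M) ≠ ⊥ ∧ I = J) ∨
        (Subgroup.center (reflGroup M) = ⊥ ∧ I = dualSet J)) →
      numUnivalent M G p q = 1) ∧
    (¬ ((Subgroup.center (reflGroup M) ≠ ⊥ ∧ I = J) ∨
        (Subgroup.center (reflGroup M) = ⊥ ∧ I = dualSet J)) →
      numUnivalent M G p q = 0) := by
  have := hM.finite_reflGroup
  exact mainTheorem4_general M hM.coxeterGraph_eq_pathGraph I J hI hJ p q hp hq hpq G hG
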